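/- Let $l$ be a line in $\mathbb{R}^3$, let $R>0$, and let $\Gamma$ be a circle of radius $R$ with centre on $l$, lying in a plane perpendicular to $l$. For a point $X\in l$ let $\mathcal{U}_X=\bigcup_{A\in\Gamma}[X,A]$ be the conical surface (umbrella) with vertex $X$ over $\Gamma$. Let $O_0\neq O_1$ be two points of $l$ and let $\mathcal{D}$ be the dicone with vertices $O_0,O_1$, that is, the body bounded by $\mathcal{U}_{O_0}$ and $\mathcal{U}_{O_1}$; equivalently, $\mathcal{D}$ is the union over $A\in\Gamma$ of the triangles $O_0O_1A$ (so $\mathcal{D}$ need not be convex). Let $f:\mathcal{D}\to\mathbb{R}$ be a convex function (if $\mathcal{D}$ is not convex, this means that $f$ is convex on every convex subset of $\mathcal{D}$), and put $g(\mathbf{x})=\dfrac{f(\mathbf{x})}{\operatorname{dist}(\mathbf{x},l)}$, where $\operatorname{dist}(\mathbf{x},l)$ is the distance from $\mathbf{x}$ to $l$. Assume that $g$ is integrable with respect to surface area on $\mathcal{U}_{O_0}$ and on $\mathcal{U}_{O_1}$. Then $f$ is integrable on $\mathcal{D}$ and $$\operatorname{Avg}(f,\mathcal{D})\le\frac{R}{4}\left(\operatorname{Avg}(g,\mathcal{U}_{O_0})+\operatorname{Avg}(g,\mathcal{U}_{O_1})\right),$$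 where $\operatorname{Avg}(f,\mathcal{D})$ is the average of $f$ over $\mathcal{D}$ with respect to volume and $\operatorname{Avg}(g,\mathcal{U}_{O_i})$ is the average of $g$ over $\mathcal{U}_{O_i}$ with respect to surface area. -/

import Mathlib

open MeasureTheory Measure

noncomputable section

namespace Dicone

/-- Euclidean three-space. -/
abbrev E3 : Type := EuclideanSpace ℝ (Fin 3)

/-- The line through `c` with direction `u`. -/
def axis (c u : E3) : AffineSubspace ℝ E3 :=
  AffineSubspace.mk' c (Submodule.span ℝ {u})

/-- The circle of centre `c` and radius `R` in the plane through `c` orthogonal to `u`. -/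
def baseCircle (c u : E3) (R : ℝ) : Set E3 :=
  {A | inner ℝ (A - c) u = 0 ∧ dist A c = R}

/-- The (conical) umbrella with vertex `X` over the base circle: the union of all segments
joining `X` to points of the circle. -/
def umbrella (c u : E3) (R : ℝ) (X : E3) : Set E3 :=
  ⋃ A ∈ baseCircle c u R, segment ℝ X A

/-- The dicone with vertices `O₀`, `O₁` over the base circle: the solid swept out by the
triangles `O₀O₁A`, `A` on the circle. For `O₀`, `O₁` two distinct points of the axis this is the
body bounded by the umbrellas with vertices `O₀` and `O₁`. It need not be convex. -/
def dicone (c u : E3) (R : ℝ) (O₀ O₁ : E3) : Set E3 :=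
  ⋃ A ∈ baseCircle c u R, convexHull ℝ {O₀, O₁, A}

/-- `f` is a convex function on the (not necessarily convex) set `D`: the restriction of `f` to
each convex subset of `D` is convex. -/
def IsConvexFunOn (D : Set E3) (f : E3 → ℝ) : Prop :=
  ∀ C ⊆ D, Convex ℝ C → ConvexOn ℝ C f

/-- On a convex set this is the usual notion. -/
theorem isConvexFunOn_iff {D : Set E3} (hD : Convex ℝ D) (f : E3 → ℝ) :
    IsConvexFunOn D f ↔ ConvexOn ℝ D f :=
  ⟨fun h => h D subset_rfl hD, fun h _ hCD hC => h.subset hCD hC⟩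

/-- Average of `f` over a solid body, with respect to volume. -/
def volAvg (f : E3 → ℝ) (D : Set E3) : ℝ := (volume.real D)⁻¹ * ∫ x in D, f x

/-- Surface measure: the two-dimensional Hausdorff measure (Mathlib's normalisation constant
plays no role in averages or integrability). -/
def surfaceMeasure : Measure E3 := hausdorffMeasure 2

/-- Average of `g` over a surface, with respect to surface area. -/
def surfAvg (g : E3 → ℝ) (U : Set E3) : ℝ :=
  (surfaceMeasure.real U)⁻¹ * ∫ x in U, g x ∂surfaceMeasure

/-- The function `f` divided by the distance to the line `l`. -/
def divDist (f : E3 → ℝ) (l : AffineSubspace ℝ E3) (x : E3) : ℝ :=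
  f x / Metric.infDist x (l : Set E3)

end Dicone

end

/-! Each point of the dicone is described by a radius `r` in `[0,1]`, an angle `w`, and a position
`l` in `[0,1]` along the vertical chord. With `l` fixed, `r` runs along a segment from a point of
`O₀O₁` to a point of the circle; with `r` fixed, `l` runs affinely between the two umbrellas. Both
motions stay in one triangle `O₀O₁A`, so `f` is convex in `r` and in `l` even if the dicone is not
convex.

Volume has density proportional to `r(1-r)`: `r` is the polar Jacobian and `1-r` the relative chord
length (`restrict_dicone_eq`). Surface area on an umbrella is a constant times `r dr dw`, and the
distance to the axis is `R r`, so dividing by it leaves the unweighted integral of `f` in `dr dw`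
(`integrable_cone_and_surfAvg_eq`). Convexity in `l` bounds the solid integral by half the sum of
the weighted integrals over the umbrellas; convexity in `r` replaces the weight `r(1-r)` by its mean
`1/6` (`integral_mul_one_sub_mul_le`). Together with the total volume mass this gives `R/4`.

Integrability needs a lower bound as well, obtained from midpoint convexity and a uniform bound for
`f` on one interior circle (`exists_le_solid`). Surface area is identified without an area formula:
the cone is homogeneous under complex multiplication, which forces the density of its Hausdorff
measure to be constant (`exists_hausdorffMeasure_image_eq`). -/

noncomputable section

namespace Dicone

open Set
open scoped ENNReal NNReal Pointwise

/-! ### One-dimensional and fibrewise inequalities -/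

/-- The parabolic weight is dominated in the mean by its average against convex functions. -/
theorem integral_mul_one_sub_mul_le {φ : ℝ → ℝ} (hφ : ConvexOn ℝ (Icc 0 1) φ)
    (hi : IntegrableOn φ (Ioo 0 1)) :
    ∫ r in Ioo (0 : ℝ) 1, r * (1 - r) * φ r ≤ 1 / 6 * ∫ r in Ioo (0 : ℝ) 1, φ r := by
  -- The numbers `1/2 ± d` are the roots of `r(1-r) - 1/6`, where `1/6` is the mean of the weight.
  -- The affine function `q + m(r - 1/2)` is the chord of `φ` through these two nodes.
  obtain ⟨d, hd0, hd⟩ : ∃ d : ℝ, 0 < d ∧ d ^ 2 = 1 / 12 :=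
    ⟨√(1 / 12), by positivity, Real.sq_sqrt (by norm_num)⟩
  have hd1 : d < 1 / 2 := by nlinarith
  set m := (φ (1 / 2 + d) - φ (1 / 2 - d)) / (2 * d) with hm
  set q := (φ (1 / 2 + d) + φ (1 / 2 - d)) / 2 with hq
  have ha : φ (1 / 2 - d) = q - m * d := by rw [hm, hq]; field_simp; ring
  have hb : φ (1 / 2 + d) = q + m * d := by rw [hm, hq]; field_simp; ring
  -- Between the nodes the centred weight is positive and `φ` lies below its chord; outside them
  -- both signs flip.
  have key : ∀ r ∈ Ioo (0 : ℝ) 1,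
      (r * (1 - r) - 1 / 6) * φ r ≤ (r * (1 - r) - 1 / 6) * (q + m * (r - 1 / 2)) := by
    intro r hr
    have hk : r * (1 - r) - 1 / 6 = (r - (1 / 2 - d)) * ((1 / 2 + d) - r) := by
      linear_combination -hd
    rw [hk]
    have m1 : (1 / 2 - d) ∈ Icc (0 : ℝ) 1 := ⟨by linarith, by linarith⟩
    have m2 : (1 / 2 + d) ∈ Icc (0 : ℝ) 1 := ⟨by linarith, by linarith⟩
    have m3 : r ∈ Icc (0 : ℝ) 1 := ⟨hr.1.le, hr.2.le⟩
    rcases lt_trichotomy r (1 / 2 - d) with h | h | h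
    · have := hφ.slope_mono_adjacent m3 m2 h (by linarith)
      rw [ha, hb, div_le_div_iff₀ (by linarith) (by linarith)] at this
      have h2 : q + m * (r - 1 / 2) ≤ φ r := by
        have : 0 ≤ (2 * d) * (φ r - (q + m * (r - 1 / 2))) := by nlinarith
        have := nonneg_of_mul_nonneg_right this (by linarith)
        linarith
      have : (r - (1 / 2 - d)) * ((1 / 2 + d) - r) ≤ 0 :=
        mul_nonpos_of_nonpos_of_nonneg (by linarith) (by linarith)
      exact mul_le_mul_of_nonpos_left h2 this
    · simp [h]
    rcases lt_trichotomy r (1 / 2 + d) with h' | h' | h'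
    · have := hφ.slope_mono_adjacent m1 m2 h h'
      rw [ha, hb, div_le_div_iff₀ (by linarith) (by linarith)] at this
      have h2 : φ r ≤ q + m * (r - 1 / 2) := by
        have : 0 ≤ (2 * d) * ((q + m * (r - 1 / 2)) - φ r) := by nlinarith
        have := nonneg_of_mul_nonneg_right this (by linarith)
        linarith
      exact mul_le_mul_of_nonneg_left h2 (mul_nonneg (by linarith) (by linarith))
    · simp [h']
    · have := hφ.slope_mono_adjacent m1 m3 (y := 1 / 2 + d) (by linarith) h'
      rw [ha, hb, div_le_div_iff₀ (by linarith) (by linarith)] at this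
      have h2 : q + m * (r - 1 / 2) ≤ φ r := by
        have : 0 ≤ (2 * d) * (φ r - (q + m * (r - 1 / 2))) := by nlinarith
        have := nonneg_of_mul_nonneg_right this (by linarith)
        linarith
      exact mul_le_mul_of_nonpos_left h2
        (mul_nonpos_of_nonneg_of_nonpos (by linarith) (by linarith))
  have hw : IntegrableOn (fun r => r * (1 - r) * φ r) (Ioo 0 1) := by
    refine Integrable.bdd_mul (c := 1) hi (by fun_prop) ?_
    refine (ae_restrict_iff' measurableSet_Ioo).2 (.of_forall fun r hr => ?_)
    rw [Real.norm_eq_abs, abs_le]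
    constructor <;> nlinarith [hr.1, hr.2]
  have hl : IntegrableOn (fun r : ℝ => (r * (1 - r) - 1 / 6) * (q + m * (r - 1 / 2)))
      (Ioo 0 1) := by
    refine (Continuous.integrableOn_Icc ?_).mono_set Ioo_subset_Icc_self
    fun_prop
  -- The centred weight has mean zero and is symmetric about `1/2`, hence is orthogonal to all
  -- affine functions.
  have h0 : ∫ r in Ioo (0 : ℝ) 1, (r * (1 - r) - 1 / 6) * (q + m * (r - 1 / 2)) = 0 := by
    rw [← integral_Ioc_eq_integral_Ioo, ← intervalIntegral.integral_of_le zero_le_one]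
    have : ∀ r : ℝ, (r * (1 - r) - 1 / 6) * (q + m * (r - 1 / 2)) =
      (-m) * r ^ 3 + (3 / 2 * m - q) * r ^ 2 + (q - 2 / 3 * m) * r + (m / 12 - q / 6) := by
      intro r; ring
    simp_rw [this]
    have e : ∀ x : ℝ, HasDerivAt (fun r : ℝ => (-m) / 4 * r ^ 4 + (3 / 2 * m - q) / 3 * r ^ 3 +
        (q - 2 / 3 * m) / 2 * r ^ 2 + (m / 12 - q / 6) * r)
        ((-m) * x ^ 3 + (3 / 2 * m - q) * x ^ 2 + (q - 2 / 3 * m) * x + (m / 12 - q / 6)) x := by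
      intro x
      refine (((((hasDerivAt_pow 4 x).const_mul ((-m) / 4)).add
        ((hasDerivAt_pow 3 x).const_mul ((3 / 2 * m - q) / 3))).add
        ((hasDerivAt_pow 2 x).const_mul ((q - 2 / 3 * m) / 2))).add
        ((hasDerivAt_id x).const_mul (m / 12 - q / 6))).congr_deriv ?_
      push_cast
      ring
    rw [intervalIntegral.integral_eq_sub_of_hasDerivAt (fun x _ => e x)
      (Continuous.intervalIntegrable (by fun_prop) _ _)]
    ring
  have : ∫ r in Ioo (0 : ℝ) 1, (r * (1 - r) * φ r - 1 / 6 * φ r) ≤ _ :=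
    setIntegral_mono_on (hw.sub (hi.const_mul (1 / 6))) hl measurableSet_Ioo
      (fun r hr => by simpa only [sub_mul] using key r hr)
  rw [h0, integral_sub hw (hi.const_mul _), integral_const_mul] at this
  linarith

/-- Lebesgue measure on the open unit interval. -/
def unitMeasure : Measure ℝ := volume.restrict (Ioo 0 1)

instance : IsProbabilityMeasure unitMeasure := ⟨by simp [unitMeasure]⟩

theorem ae_unitMeasure_mem : ∀ᵐ r ∂unitMeasure, r ∈ Ioo (0 : ℝ) 1 :=
  ae_restrict_mem measurableSet_Ioo

theorem measurePreserving_one_sub :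
    MeasurePreserving (fun r : ℝ => 1 - r) unitMeasure unitMeasure := by
  have h := (measurePreserving_sub_left (volume : Measure ℝ) 1).restrict_preimage
    (s := Ioo 0 1) measurableSet_Ioo
  have e : (fun r : ℝ => 1 - r) ⁻¹' Ioo 0 1 = Ioo 0 1 := by
    ext r; simp
  rwa [e] at h

theorem integral_unitMeasure_id : ∫ r, r ∂unitMeasure = 1 / 2 := by
  rw [unitMeasure, ← integral_Ioc_eq_integral_Ioo, ← intervalIntegral.integral_of_le zero_le_one]
  simp

theorem integral_unitMeasure_mul_one_sub : ∫ r, r * (1 - r) ∂unitMeasure = 1 / 6 := by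
  rw [unitMeasure, ← integral_Ioc_eq_integral_Ioo, ← intervalIntegral.integral_of_le zero_le_one]
  have : ∀ r : ℝ, r * (1 - r) = r - r ^ 2 := fun r => by ring
  simp_rw [this]
  rw [intervalIntegral.integral_sub (by simp) (by simp)]
  norm_num

section Core

variable {Ω : Type*} [MeasurableSpace Ω] {μ : Measure Ω}

theorem ae_prod_unitMeasure_mem : ∀ᵐ p : ℝ × Ω ∂unitMeasure.prod μ, p.1 ∈ Ioo (0 : ℝ) 1 :=
  quasiMeasurePreserving_fst.ae ae_unitMeasure_mem

theorem ae_prod_prod_unitMeasure_mem : ∀ᵐ p : (ℝ × Ω) × ℝ ∂(unitMeasure.prod μ).prod unitMeasure,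
    p.1.1 ∈ Ioo (0 : ℝ) 1 ∧ p.2 ∈ Ioo (0 : ℝ) 1 :=
  (quasiMeasurePreserving_fst.ae ae_prod_unitMeasure_mem).and
    (quasiMeasurePreserving_snd.ae ae_unitMeasure_mem)

variable [IsFiniteMeasure μ]

/-- The fibrewise form of the parabolic inequality. -/
theorem integral_prod_mul_one_sub_mul_le {G : ℝ × Ω → ℝ}
    (hG : ∀ w, ConvexOn ℝ (Icc 0 1) (fun r => G (r, w)))
    (hi : Integrable G (unitMeasure.prod μ)) :
    Integrable (fun p => p.1 * (1 - p.1) * G p) (unitMeasure.prod μ) ∧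
    ∫ p, p.1 * (1 - p.1) * G p ∂unitMeasure.prod μ ≤ 1 / 6 * ∫ p, G p ∂unitMeasure.prod μ := by
  have hw : Integrable (fun p => p.1 * (1 - p.1) * G p) (unitMeasure.prod μ) := by
    refine Integrable.bdd_mul (c := 1) hi (by fun_prop) ?_
    filter_upwards [ae_prod_unitMeasure_mem] with p hp
    rw [Real.norm_eq_abs, abs_le]
    constructor <;> nlinarith [hp.1, hp.2]
  refine ⟨hw, ?_⟩
  rw [integral_prod_symm _ hw, integral_prod_symm _ hi, ← integral_const_mul]
  refine integral_mono_ae hw.integral_prod_right (hi.integral_prod_right.const_mul _) ?_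
  filter_upwards [hi.prod_left_ae] with w h
  exact integral_mul_one_sub_mul_le (hG w) h

/-- The weighted Hermite–Hadamard inequality for families of triangles. -/
theorem integrable_and_integral_le {F : ℝ × Ω → ℝ → ℝ} {M : ℝ}
    (hr : ∀ w, ∀ l ∈ Icc (0 : ℝ) 1, ConvexOn ℝ (Icc 0 1) (fun r => F (r, w) l))
    (hl : ∀ w, ∀ r ∈ Icc (0 : ℝ) 1, ConvexOn ℝ (Icc 0 1) (F (r, w)))
    (hm : AEStronglyMeasurable (fun p : (ℝ × Ω) × ℝ => F p.1 p.2)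
      ((unitMeasure.prod μ).prod unitMeasure))
    (hM : ∀ w, M ≤ F (1 / 2, w) (1 / 2))
    (h0 : Integrable (fun p => F p 0) (unitMeasure.prod μ))
    (h1 : Integrable (fun p => F p 1) (unitMeasure.prod μ)) :
    Integrable (fun p : (ℝ × Ω) × ℝ => p.1.1 * (1 - p.1.1) * F p.1 p.2)
      ((unitMeasure.prod μ).prod unitMeasure) ∧
    ∫ p, p.1.1 * (1 - p.1.1) * F p.1 p.2 ∂(unitMeasure.prod μ).prod unitMeasure ≤
      1 / 12 * (∫ p, F p 0 ∂unitMeasure.prod μ + ∫ p, F p 1 ∂unitMeasure.prod μ) := by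
  have half : (1 / 2 : ℝ) ∈ Icc (0 : ℝ) 1 := by norm_num
  have upper : ∀ w, ∀ r ∈ Icc (0 : ℝ) 1, ∀ l ∈ Icc (0 : ℝ) 1,
      F (r, w) l ≤ (1 - l) * F (r, w) 0 + l * F (r, w) 1 := by
    intro w r hr' l hl'
    have := (hl w r hr').2 (left_mem_Icc.2 zero_le_one)
      (right_mem_Icc.2 zero_le_one) (sub_nonneg.2 hl'.2) hl'.1 (sub_add_cancel 1 l)
    simpa using this
  -- Reflection in `l` and then in `r` bounds `F` from below by upper bounds at the reflected points
  -- and the value at the centre `(1/2, 1/2)`.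
  have midl : ∀ w, ∀ r ∈ Icc (0 : ℝ) 1, ∀ l ∈ Icc (0 : ℝ) 1,
      2 * F (r, w) (1 / 2) ≤ F (r, w) l + F (r, w) (1 - l) := by
    intro w r hr' l hl'
    have := (hl w r hr').2 hl' (Icc.mem_iff_one_sub_mem.1 hl')
      half.1 half.1 (add_halves 1)
    simp only [smul_eq_mul] at this
    rw [show (1 / 2 : ℝ) * l + 1 / 2 * (1 - l) = 1 / 2 by ring] at this
    linarith
  have midr : ∀ w, ∀ r ∈ Icc (0 : ℝ) 1,
      2 * M ≤ F (r, w) (1 / 2) + F (1 - r, w) (1 / 2) := by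
    intro w r hr'
    have := (hr w (1 / 2) half).2 hr' (Icc.mem_iff_one_sub_mem.1 hr')
      half.1 half.1 (add_halves 1)
    simp only [smul_eq_mul] at this
    rw [show (1 / 2 : ℝ) * r + 1 / 2 * (1 - r) = 1 / 2 by ring] at this
    linarith [hM w]
  set ν := unitMeasure.prod μ
  set B : ℝ × Ω → ℝ := fun p => |F p 0| + |F p 1| with hB
  have hBi : Integrable B ν := h0.abs.add h1.abs
  have hrefl : MeasurePreserving (fun p : ℝ × Ω => (1 - p.1, p.2)) ν ν :=
    measurePreserving_one_sub.prod (MeasurePreserving.id μ)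
  have hBr : Integrable (fun p : ℝ × Ω => B (1 - p.1, p.2)) ν :=
    hrefl.integrable_comp_of_integrable hBi
  have hupB : ∀ w, ∀ r ∈ Icc (0 : ℝ) 1, ∀ l ∈ Icc (0 : ℝ) 1, F (r, w) l ≤ B (r, w) := by
    intro w r hr' l hl'
    refine (upper w r hr' l hl').trans (add_le_add ?_ ?_)
    · calc _ ≤ (1 - l) * |F (r, w) 0| :=
            mul_le_mul_of_nonneg_left (le_abs_self _) (by linarith [hl'.2])
        _ ≤ _ := mul_le_of_le_one_left (abs_nonneg _) (by linarith [hl'.1])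
    · calc _ ≤ l * |F (r, w) 1| :=
            mul_le_mul_of_nonneg_left (le_abs_self _) hl'.1
        _ ≤ _ := mul_le_of_le_one_left (abs_nonneg _) hl'.2
  have hF : Integrable (fun p : (ℝ × Ω) × ℝ => F p.1 p.2) (ν.prod unitMeasure) := by
    -- The two reflections give `F (r, w) l ≥ 4M - 2B(1-r, w) - B(r, w)`, while `B` bounds `F` from
    -- above.
    have hdom : Integrable (fun p : ℝ × Ω => B p + (2 * B (1 - p.1, p.2) + 4 * |M|)) ν :=
      hBi.add ((hBr.const_mul 2).add (integrable_const _))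
    refine (hdom.comp_fst unitMeasure).mono' hm ?_
    filter_upwards [ae_prod_prod_unitMeasure_mem] with p hp
    obtain ⟨⟨r, w⟩, l⟩ := p
    have hr' : r ∈ Icc (0 : ℝ) 1 := ⟨hp.1.1.le, hp.1.2.le⟩
    have hl' : l ∈ Icc (0 : ℝ) 1 := ⟨hp.2.1.le, hp.2.2.le⟩
    have hr2 : 1 - r ∈ Icc (0 : ℝ) 1 := ⟨by linarith [hr'.2], by linarith [hr'.1]⟩
    have hl2 : 1 - l ∈ Icc (0 : ℝ) 1 := ⟨by linarith [hl'.2], by linarith [hl'.1]⟩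
    have i1 := midl w r hr' l hl'
    have i2 := midr w r hr'
    have i3 := hupB w r hr' l hl'
    have i4 := hupB w r hr' _ hl2
    have i5 := hupB w _ hr2 _ half
    have i6 : 0 ≤ B (1 - r, w) := by positivity
    have i7 := neg_abs_le M
    have i8 := abs_nonneg M
    simp only [Real.norm_eq_abs, abs_le]
    constructor <;> linarith
  have hw : Integrable (fun p : (ℝ × Ω) × ℝ => p.1.1 * (1 - p.1.1) * F p.1 p.2)
      (ν.prod unitMeasure) := by
    refine Integrable.bdd_mul (c := 1) hF (by fun_prop) ?_
    filter_upwards [ae_prod_prod_unitMeasure_mem] with p hp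
    rw [Real.norm_eq_abs, abs_le]
    constructor <;> nlinarith [hp.1.1, hp.1.2]
  refine ⟨hw, ?_⟩
  obtain ⟨k0, j0⟩ := integral_prod_mul_one_sub_mul_le (fun w => hr w 0 (by simp)) h0
  obtain ⟨k1, j1⟩ := integral_prod_mul_one_sub_mul_le (fun w => hr w 1 (by simp)) h1
  have hid : Integrable (fun l : ℝ => l) unitMeasure :=
    (continuous_id.integrableOn_Icc).mono_set Ioo_subset_Icc_self
  have hid' : Integrable (fun l : ℝ => 1 - l) unitMeasure := (integrable_const _).sub hid
  have hid2 : ∫ l, (1 - l) ∂unitMeasure = 1 / 2 := by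
    rw [integral_sub (integrable_const _) hid, integral_unitMeasure_id]
    norm_num
  have hU := (k0.mul_prod hid').add (k1.mul_prod hid)
  -- Convexity in `l` comes first: `l` and `1 - l` each integrate to `1/2`. The parabolic inequality
  -- on the two faces then supplies `1/6`.
  calc _ ≤ ∫ p : (ℝ × Ω) × ℝ, (p.1.1 * (1 - p.1.1) * F p.1 0 * (1 - p.2) +
        p.1.1 * (1 - p.1.1) * F p.1 1 * p.2) ∂ν.prod unitMeasure := by
        refine integral_mono_ae hw hU ?_
        filter_upwards [ae_prod_prod_unitMeasure_mem] with p hp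
        obtain ⟨⟨r, w⟩, l⟩ := p
        have := mul_le_mul_of_nonneg_left (upper w r ⟨hp.1.1.le, hp.1.2.le⟩ l
          ⟨hp.2.1.le, hp.2.2.le⟩) (mul_nonneg hp.1.1.le (sub_nonneg.2 hp.1.2.le))
        simp only at this ⊢
        exact this.trans_eq (by ring)
    _ = (∫ p, p.1 * (1 - p.1) * F p 0 ∂ν) * (1 / 2) +
        (∫ p, p.1 * (1 - p.1) * F p 1 ∂ν) * (1 / 2) := by
        rw [integral_add (k0.mul_prod hid') (k1.mul_prod hid),
          integral_prod_mul (μ := ν) (ν := unitMeasure)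
            (fun p => p.1 * (1 - p.1) * F p 0) (fun l => 1 - l),
          integral_prod_mul (μ := ν) (ν := unitMeasure)
            (fun p => p.1 * (1 - p.1) * F p 1) (fun l => l), hid2, integral_unitMeasure_id]
    _ ≤ _ := by linarith

end Core

/-! ### Hausdorff measure on homogeneous surfaces -/

/-- A measurable function on `ℂ` which is a.e. invariant under each nonzero multiplication is a.e.
constant. -/
theorem exists_ae_eq_const_of_mul_invariant {η : Measure ℂ} [SFinite η] [NullSingletonClass η] [NeZero η]
    (hη : ∀ a : ℂ, a ≠ 0 → QuasiMeasurePreserving (fun z => a * z) η η)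
    {ρ : ℂ → ℝ≥0∞} (hρ : Measurable ρ)
    (h : ∀ a : ℂ, a ≠ 0 → ∀ᵐ z ∂η, ρ (a * z) = ρ z) : ∃ κ, ∀ᵐ z ∂η, ρ z = κ := by
  have h1 : ∀ᵐ a : ℂ ∂η, ∀ᵐ z : ℂ ∂η, ρ (a * z) = ρ z := by
    filter_upwards [Measure.ae_ne η (0 : ℂ)] with a ha using h a ha
  have hms : MeasurableSet {p : ℂ × ℂ | ρ (p.1 * p.2) = ρ p.2} :=
    measurableSet_eq_fun (by fun_prop) (by fun_prop)
  -- Exchanging the quantifiers by Fubini yields one `z ≠ 0` with `ρ (a * z) = ρ z` for almost every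
  -- `a`; the substitution `a = z⁻¹ * w` then covers almost every `w`.
  have h2 : ∀ᵐ z : ℂ ∂η, ∀ᵐ a : ℂ ∂η, ρ (a * z) = ρ z :=
    (ae_ae_comm (p := fun a z => ρ (a * z) = ρ z) hms).1 h1
  obtain ⟨z, hz0, hz⟩ := ((Measure.ae_ne η (0 : ℂ)).and h2).exists
  refine ⟨ρ z, ?_⟩
  filter_upwards [(hη z⁻¹ (inv_ne_zero hz0)).ae hz] with w hw
  rwa [mul_right_comm, inv_mul_cancel₀ hz0, one_mul] at hw

section Homogeneous

variable {X : Type*} [MetricSpace X] [MeasurableSpace X] [BorelSpace X] {Ψ : ℂ → X}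

/-- Multiplication by `a`, transported to the surface through `Ψ`, is `‖a‖`-Lipschitz, and
two-dimensional measure grows by at most the square. -/
theorem hausdorffMeasure_image_mul_image_le
    (hd : ∀ a z w, dist (Ψ (a * z)) (Ψ (a * w)) = ‖a‖ * dist (Ψ z) (Ψ w))
    (hinj : Function.Injective Ψ) (a : ℂ) (E : Set ℂ) :
    μH[2] (Ψ '' ((fun z => a * z) '' E)) ≤ (‖a‖₊ : ℝ≥0∞) ^ 2 * μH[2] (Ψ '' E) := by
  have hL : LipschitzOnWith ‖a‖₊ (fun x => Ψ (a * Function.invFun Ψ x)) (Ψ '' E) := by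
    refine LipschitzOnWith.of_dist_le_mul ?_
    rintro _ ⟨z, -, rfl⟩ _ ⟨w, -, rfl⟩
    simp [Function.leftInverse_invFun hinj _, hd]
  have := hL.hausdorffMeasure_image_le (d := 2) (by norm_num)
  rw [image_image] at this ⊢
  simpa [Function.leftInverse_invFun hinj _] using this

/-- The one-sided estimate applied to both `a` and `a⁻¹` becomes an equality. -/
theorem comap_hausdorffMeasure_preimage_mul
    (hd : ∀ a z w, dist (Ψ (a * z)) (Ψ (a * w)) = ‖a‖ * dist (Ψ z) (Ψ w))
    (hΨ : MeasurableEmbedding Ψ) {a : ℂ} (ha : a ≠ 0) (E : Set ℂ) :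
    (‖a‖₊ : ℝ≥0∞) ^ 2 * (μH[2]).comap Ψ ((fun z => a * z) ⁻¹' E) = (μH[2]).comap Ψ E := by
  have hs : (fun z => a * z) '' ((fun z => a * z) ⁻¹' E) = E :=
    image_preimage_eq _ (mul_left_surjective₀ ha)
  have hs' : (fun z => a⁻¹ * z) '' E = (fun z => a * z) ⁻¹' E := by
    conv_lhs => rw [← hs, image_image]
    simp [ha]
  rw [hΨ.comap_apply, hΨ.comap_apply]
  apply le_antisymm
  · have := hausdorffMeasure_image_mul_image_le hd hΨ.injective a⁻¹ E
    rw [hs'] at this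
    calc _ ≤ (‖a‖₊ : ℝ≥0∞) ^ 2 * ((‖a⁻¹‖₊ : ℝ≥0∞) ^ 2 * μH[2] (Ψ '' E)) := by gcongr
      _ = _ := by
        rw [← mul_assoc, ← mul_pow, ← ENNReal.coe_mul, ← nnnorm_mul, mul_inv_cancel₀ ha]
        simp
  · have := hausdorffMeasure_image_mul_image_le hd hΨ.injective a ((fun z => a * z) ⁻¹' E)
    rwa [hs] at this

/-- Taking `Ψ` to be the identity gives the same scaling factor for the planar measure, which is why
the density between the two is invariant. -/
theorem map_mul_comap_hausdorffMeasure
    (hd : ∀ a z w, dist (Ψ (a * z)) (Ψ (a * w)) = ‖a‖ * dist (Ψ z) (Ψ w))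
    (hΨ : MeasurableEmbedding Ψ) {a : ℂ} (ha : a ≠ 0) :
    ((μH[2]).comap Ψ).map (fun z => a * z) = ((‖a‖₊ : ℝ≥0∞) ^ 2)⁻¹ • (μH[2]).comap Ψ := by
  ext E hE
  rw [map_apply (by fun_prop) hE, Measure.smul_apply, smul_eq_mul,
    ← comap_hausdorffMeasure_preimage_mul hd hΨ ha E, ← mul_assoc, ENNReal.inv_mul_cancel, one_mul]
  · simpa using ha
  · simp

instance isAddHaarMeasure_hausdorffMeasure_complex : IsAddHaarMeasure (μH[2] : Measure ℂ) := by
  have := isAddHaarMeasure_hausdorffMeasure (E := ℂ)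
  rw [Complex.finrank_real_complex] at this
  exact_mod_cast this

/-- A bi-Lipschitz embedding of the plane whose metric is homogeneous under complex multiplication
transports Lebesgue measure to a multiple of surface measure. -/
theorem exists_hausdorffMeasure_image_eq {K K' : ℝ≥0}
    (hd : ∀ a z w, dist (Ψ (a * z)) (Ψ (a * w)) = ‖a‖ * dist (Ψ z) (Ψ w))
    (hK : LipschitzWith K Ψ) (hK' : AntilipschitzWith K' Ψ) :
    ∃ κ : ℝ≥0∞, κ ≠ 0 ∧ κ ≠ ∞ ∧ ∀ E : Set ℂ, MeasurableSet E → μH[2] (Ψ '' E) = κ * volume E := by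
  have hΨ : MeasurableEmbedding Ψ := hK.continuous.measurableEmbedding hK'.injective
  set η : Measure ℂ := μH[2] with hη
  set ν : Measure ℂ := (μH[2]).comap Ψ with hν
  -- The bi-Lipschitz bounds sandwich `ν` between multiples of `η`: this gives σ-finiteness and
  -- absolute continuity, and later excludes the values `0` and `∞` for the density.
  have hνη : ν ≤ ((K : ℝ≥0∞) ^ 2) • η := by
    refine Measure.le_iff.2 fun E _ => ?_
    rw [hν, hΨ.comap_apply, Measure.smul_apply, smul_eq_mul]
    simpa using hK.hausdorffMeasure_image_le (d := 2) (by norm_num) E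
  have hην : ∀ E, η E ≤ (K' : ℝ≥0∞) ^ 2 * ν E := by
    intro E
    rw [hν, hΨ.comap_apply]
    simpa using hK'.le_hausdorffMeasure_image (d := 2) (by norm_num) E
  have : SigmaFinite (((K : ℝ≥0∞) ^ 2) • η) := by
    have : ((K : ℝ≥0∞) ^ 2) • η = (K ^ 2) • η := by
      rw [← ENNReal.coe_pow]; rfl
    rw [this]
    infer_instance
  have : SigmaFinite ν := sigmaFinite_of_le _ hνη
  have hac : ν ≪ η := hνη.absolutelyContinuous.trans (smul_absolutelyContinuous)
  have hmap : ∀ a : ℂ, a ≠ 0 → η.map (fun z => a * z) = ((‖a‖₊ : ℝ≥0∞) ^ 2)⁻¹ • η := by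
    intro a ha
    have := map_mul_comap_hausdorffMeasure (Ψ := fun z : ℂ => z) (by simp [dist_eq_norm, ← mul_sub])
      MeasurableEmbedding.id ha
    simpa only [Measure.comap_id] using this
  have hdens : η.withDensity (ν.rnDeriv η) = ν := withDensity_rnDeriv_eq _ _ hac
  set ρ := ν.rnDeriv η with hρ
  have hρm : Measurable ρ := measurable_rnDeriv _ _
  -- Both measures scale by the same power of `‖a‖`, so `z ↦ ρ (a * z)` is again a density of `ν`
  -- with respect to `η`; uniqueness of densities gives the invariance.
  obtain ⟨κ, hκ⟩ := exists_ae_eq_const_of_mul_invariant (η := η) (ρ := ρ)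
    (fun a ha => ⟨by fun_prop, by rw [hmap a ha]; exact smul_absolutelyContinuous⟩) hρm (by
      intro a ha
      refine (withDensity_eq_iff_of_sigmaFinite (f := fun z => ρ (a * z)) (g := ρ) (μ := η)
        (by fun_prop) (by fun_prop)).1 ?_
      rw [hdens]
      ext E hE
      obtain ⟨E', hE', rfl⟩ : ∃ E', MeasurableSet E' ∧ (fun z => a * z) ⁻¹' E' = E :=
        ⟨(fun z => a⁻¹ * z) ⁻¹' E, (by fun_prop : Measurable fun z : ℂ => a⁻¹ * z) hE, by
          ext z; simp [ha]⟩
      have e : (‖a‖₊ : ℝ≥0∞) ^ 2 ≠ 0 := by simpa using ha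
      rw [withDensity_apply _ hE, ← setLIntegral_map hE' hρm (by fun_prop), hmap a ha,
        Measure.restrict_smul, lintegral_smul_measure, ← withDensity_apply _ hE', hdens, hν,
        ← comap_hausdorffMeasure_preimage_mul hd hΨ ha E', smul_eq_mul, ← mul_assoc,
        ENNReal.inv_mul_cancel e (by simp), one_mul])
  have hνκ : ν = κ • η := by
    rw [← hdens, withDensity_congr_ae (g := fun _ => κ) hκ, withDensity_const]
  obtain ⟨k, hk0, hk⟩ : ∃ k : ℝ≥0, k ≠ 0 ∧ η = k • (volume : Measure ℂ) :=
    ⟨addHaarScalarFactor η volume, (addHaarScalarFactor_pos_of_isAddHaarMeasure η volume).ne',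
      isAddLeftInvariant_eq_smul η volume⟩
  have hb0 : η (Metric.ball 0 1) ≠ 0 := (Metric.measure_ball_pos η 0 one_pos).ne'
  have hbt : η (Metric.ball 0 1) ≠ ∞ := measure_ball_lt_top.ne
  refine ⟨κ * k, mul_ne_zero ?_ (by simpa using hk0), ENNReal.mul_ne_top ?_ (by simp), fun E hE => ?_⟩
  · rintro rfl
    have := hην (Metric.ball 0 1)
    rw [hνκ] at this
    simp at this
    exact hb0 this
  · rintro rfl
    have := hνη (Metric.ball 0 1)
    rw [hνκ, Measure.smul_apply, Measure.smul_apply, smul_eq_mul, smul_eq_mul, ENNReal.top_mul hb0, top_le_iff] at this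
    exact ENNReal.mul_ne_top (by simp) hbt this
  · rw [← hΨ.comap_apply, ← hν, hνκ, hk, Measure.smul_apply, Measure.smul_apply, ENNReal.smul_def, smul_eq_mul,
      smul_eq_mul, mul_assoc]

/-- The restricted form of `exists_hausdorffMeasure_image_eq`. -/
theorem exists_restrict_hausdorffMeasure_eq_map {K K' : ℝ≥0}
    (hd : ∀ a z w, dist (Ψ (a * z)) (Ψ (a * w)) = ‖a‖ * dist (Ψ z) (Ψ w))
    (hK : LipschitzWith K Ψ) (hK' : AntilipschitzWith K' Ψ) {B : Set ℂ} (hB : MeasurableSet B) :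
    ∃ κ : ℝ≥0∞, κ ≠ 0 ∧ κ ≠ ∞ ∧
      (μH[2]).restrict (Ψ '' B) = (κ • volume.restrict B).map Ψ := by
  obtain ⟨κ, h0, ht, h⟩ := exists_hausdorffMeasure_image_eq hd hK hK'
  have hΨ : MeasurableEmbedding Ψ := hK.continuous.measurableEmbedding hK'.injective
  refine ⟨κ, h0, ht, ?_⟩
  ext E hE
  rw [restrict_apply hE, map_apply hΨ.measurable hE, Measure.smul_apply,
    restrict_apply (hΨ.measurable hE), smul_eq_mul, ← h _ ((hΨ.measurable hE).inter hB),
    image_preimage_inter]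

end Homogeneous

/-! ### Orthonormal coordinates adapted to the axis -/

/-- Cylindrical-type coordinates: the point with transversal coordinate `z` and height `h`
over `c`, in an orthonormal basis whose first vector spans the axis. -/
def frame (c : E3) (b : OrthonormalBasis (Fin 3) ℝ E3) (z : ℂ) (h : ℝ) : E3 :=
  b.repr.symm !₂[h, z.re, z.im] + c

variable {c u : E3} {b : OrthonormalBasis (Fin 3) ℝ E3}

theorem repr_frame_sub (z : ℂ) (h : ℝ) : b.repr (frame c b z h - c) = !₂[h, z.re, z.im] := by
  simp [frame]

theorem dist_frame (z w : ℂ) (h k : ℝ) :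
    dist (frame c b z h) (frame c b w k) = √(‖z - w‖ ^ 2 + (h - k) ^ 2) := by
  rw [frame, frame, dist_add_right, LinearIsometryEquiv.dist_map, EuclideanSpace.dist_eq,
    Fin.sum_univ_three, ← Complex.normSq_eq_norm_sq, Complex.normSq_apply]
  simp only [Real.dist_eq, sq_abs]
  congr 1
  simp
  ring

theorem frame_surjective (x : E3) : ∃ z h, frame c b z h = x := by
  refine ⟨⟨b.repr (x - c) 1, b.repr (x - c) 2⟩, b.repr (x - c) 0, ?_⟩
  have : (!₂[b.repr (x - c) 0, b.repr (x - c) 1, b.repr (x - c) 2] : E3) = b.repr (x - c) := by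
    ext i; fin_cases i <;> rfl
  rw [frame]
  simp only
  rw [this]
  simp

theorem frame_injective {z w : ℂ} {h k : ℝ} (e : frame c b z h = frame c b w k) :
    z = w ∧ h = k := by
  have e' : (!₂[h, z.re, z.im] : E3) = !₂[k, w.re, w.im] := by
    rw [← repr_frame_sub (c := c) (b := b), e, repr_frame_sub]
  refine ⟨Complex.ext ?_ ?_, ?_⟩
  · simpa using congrArg (fun v : E3 => v 1) e'
  · simpa using congrArg (fun v : E3 => v 2) e'
  · simpa using congrArg (fun v : E3 => v 0) e'

theorem frame_combo (z w : ℂ) (h k : ℝ) {s t : ℝ} (hst : s + t = 1) :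
    s • frame c b z h + t • frame c b w k = frame c b (s * z + t * w) (s * h + t * k) := by
  have : (!₂[s * h + t * k, (s * z + t * w : ℂ).re, (s * z + t * w : ℂ).im] : E3) =
      s • !₂[h, z.re, z.im] + t • !₂[k, w.re, w.im] := by
    ext i; fin_cases i <;> simp
  rw [frame, frame, frame, this, map_add, map_smul, map_smul]
  have hc : c = s • c + t • c := by rw [← add_smul, hst, one_smul]
  conv_rhs => rw [hc]
  simp only [smul_add]
  abel

theorem continuous_frame : Continuous fun p : ℂ × ℝ => frame c b p.1 p.2 := by
  unfold frame
  refine (b.repr.symm.continuous.comp ?_).add continuous_const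
  refine (PiLp.continuous_toLp 2 _).comp (continuous_pi fun i => ?_)
  fin_cases i
  · exact continuous_snd
  · exact Complex.continuous_re.comp continuous_fst
  · exact Complex.continuous_im.comp continuous_fst

theorem measurePreserving_frame :
    MeasurePreserving (fun p : ℂ × ℝ => frame c b p.1 p.2) volume volume := by
  have h1 : MeasurePreserving (fun p : ℂ × ℝ => (p.2, Complex.measurableEquivPi p.1))
      volume volume :=
    ((MeasurePreserving.id volume).prod Complex.volume_preserving_equiv_pi).comp
      (measurePreserving_swap (μ := (volume : Measure ℂ)) (ν := (volume : Measure ℝ)))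
  have h2 := (volume_preserving_piFinSuccAbove (fun _ : Fin 3 => ℝ) 0).symm
  have h3 := PiLp.volume_preserving_toLp (Fin 3)
  have h4 := b.measurePreserving_repr_symm
  have h5 := measurePreserving_add_right (volume : Measure E3) c
  have := h5.comp (h4.comp (h3.comp (h2.comp h1)))
  convert this using 1
  funext p
  simp only [Function.comp, frame]
  congr 2
  ext i
  fin_cases i <;> simp [Fin.insertNthEquiv]

theorem exists_basis_zero_eq (hu : u ≠ 0) :
    ∃ b : OrthonormalBasis (Fin 3) ℝ E3, b 0 = ‖u‖⁻¹ • u := by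
  obtain ⟨b, hb⟩ := Orthonormal.exists_orthonormalBasis_extension_of_card_eq (𝕜 := ℝ) (E := E3)
    (ι := Fin 3) (by simp) (v := fun _ => ‖u‖⁻¹ • u) (s := {0}) (by
      rw [orthonormal_iff_ite]
      rintro ⟨i, hi⟩ ⟨j, hj⟩
      rw [mem_singleton_iff] at hi hj
      subst hi hj
      simp [Set.domRestrict, norm_smul, hu])
  exact ⟨b, hb 0 rfl⟩

theorem frame_sub (z : ℂ) (h : ℝ) :
    frame c b z h - c = h • b 0 + z.re • b 1 + z.im • b 2 := by
  rw [← b.sum_repr (frame c b z h - c), repr_frame_sub, Fin.sum_univ_three]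
  simp

theorem frame_mem_axis (hu : u ≠ 0) (hb : b 0 = ‖u‖⁻¹ • u) {z : ℂ} {h : ℝ} :
    frame c b z h ∈ axis c u ↔ z = 0 := by
  have hspan : Submodule.span ℝ {u} = Submodule.span ℝ {b 0} := by
    rw [hb, Submodule.span_singleton_smul_eq (by simpa using hu)]
  rw [axis, AffineSubspace.mem_mk', vsub_eq_sub, hspan, Submodule.mem_span_singleton]
  constructor
  · rintro ⟨k, hk⟩
    have : frame c b 0 k = frame c b z h := by
      rw [← sub_left_inj (a := c), ← hk, frame_sub]; simp
    exact (frame_injective this).1.symm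
  · rintro rfl
    exact ⟨h, by rw [frame_sub]; simp⟩

theorem infDist_frame_axis (hu : u ≠ 0) (hb : b 0 = ‖u‖⁻¹ • u) (z : ℂ) (h : ℝ) :
    Metric.infDist (frame c b z h) (axis c u : Set E3) = ‖z‖ := by
  have h0 : frame c b 0 h ∈ (axis c u : Set E3) := (frame_mem_axis hu hb).2 rfl
  apply le_antisymm
  · refine (Metric.infDist_le_dist_of_mem h0).trans ?_
    rw [dist_frame]
    simp
  · refine (Metric.le_infDist ⟨_, h0⟩).2 fun y hy => ?_
    obtain ⟨w, k, rfl⟩ := frame_surjective (c := c) (b := b) y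
    obtain rfl := (frame_mem_axis hu hb).1 hy
    rw [dist_frame]
    refine Real.le_sqrt_of_sq_le ?_
    simp
    positivity

theorem frame_mem_baseCircle (hu : u ≠ 0) (hb : b 0 = ‖u‖⁻¹ • u) {R : ℝ}
    {z : ℂ} {h : ℝ} : frame c b z h ∈ baseCircle c u R ↔ h = 0 ∧ ‖z‖ = R := by
  have hu' : u = ‖u‖ • b 0 := by
    rw [hb, smul_smul, mul_inv_cancel₀ (norm_ne_zero_iff.2 hu), one_smul]
  have hc : c = frame c b 0 0 := by rw [← sub_eq_zero, eq_comm, ← neg_sub, frame_sub]; simp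
  have h1 : inner ℝ (frame c b z h - c) u = ‖u‖ * h := by
    rw [frame_sub]
    conv_lhs => rw [hu']
    simp only [inner_add_left, inner_smul_left, inner_smul_right, b.inner_eq_ite]
    simp
  have h2 : dist (frame c b z h) c = √(‖z‖ ^ 2 + h ^ 2) := by
    rw [show dist (frame c b z h) c = dist (frame c b z h) (frame c b 0 0) by rw [← hc], dist_frame]
    simp
  rw [baseCircle, mem_ofPred_eq, h1, h2]
  simp only [mul_eq_zero, norm_eq_zero, hu, false_or]
  refine and_congr_right fun h0 => ?_
  rw [h0]
  simp [Real.sqrt_sq]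

/-! ### Charts of the dicone and of the umbrellas -/

/-- The chart of the solid: `z` in the unit disc is the transversal position, `l` the position on
the vertical chord. -/
def solid (c : E3) (b : OrthonormalBasis (Fin 3) ℝ E3) (R t₀ t₁ : ℝ) (z : ℂ) (l : ℝ) : E3 :=
  frame c b (R * z) ((1 - ‖z‖) * ((1 - l) * t₀ + l * t₁))

/-- The chart of the cone with vertex at height `t`. -/
def cone (c : E3) (b : OrthonormalBasis (Fin 3) ℝ E3) (R t : ℝ) (z : ℂ) : E3 :=
  frame c b (R * z) ((1 - ‖z‖) * t)

variable {R t t₀ t₁ : ℝ}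

theorem continuous_solid : Continuous fun p : ℂ × ℝ => solid c b R t₀ t₁ p.1 p.2 := by
  unfold solid
  exact continuous_frame.comp (f := fun p : ℂ × ℝ =>
    ((R : ℂ) * p.1, (1 - ‖p.1‖) * ((1 - p.2) * t₀ + p.2 * t₁))) (by fun_prop)

theorem solid_zero (z : ℂ) : solid c b R t₀ t₁ z 0 = cone c b R t₀ z := by simp [solid, cone]

theorem solid_one (z : ℂ) : solid c b R t₀ t₁ z 1 = cone c b R t₁ z := by simp [solid, cone]

theorem exists_mul_of_norm_le_one {z : ℂ} (hz : ‖z‖ ≤ 1) :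
    ∃ r ∈ Icc (0 : ℝ) 1, ∃ w : ℂ, ‖w‖ = 1 ∧ z = r * w := by
  refine ⟨‖z‖, ⟨norm_nonneg z, hz⟩, ?_⟩
  rcases eq_or_ne z 0 with rfl | h
  · exact ⟨1, by simp, by simp⟩
  · exact ⟨z / ‖z‖, by simp [h], by field_simp [norm_ne_zero_iff.2 h]⟩

/-- Along a ray the chart is an affine combination of a point of `O₀O₁` and a point of the circle;
all convexity statements and the descriptions of both bodies rest on this form. -/
theorem solid_mul {r : ℝ} (hr : 0 ≤ r) {w : ℂ} (hw : ‖w‖ = 1) (l : ℝ) :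
    solid c b R t₀ t₁ (r * w) l =
      (1 - r) • frame c b 0 ((1 - l) * t₀ + l * t₁) + r • frame c b (R * w) 0 := by
  rw [frame_combo _ _ _ _ (by ring), solid, norm_mul, hw, Complex.norm_real, Real.norm_of_nonneg hr]
  congr 1
  · push_cast; ring
  · ring

theorem frame_zero_combo (l : ℝ) :
    frame c b 0 ((1 - l) * t₀ + l * t₁) = (1 - l) • frame c b 0 t₀ + l • frame c b 0 t₁ := by
  rw [frame_combo _ _ _ _ (by ring)]; simp

theorem umbrella_eq (hu : u ≠ 0) (hb : b 0 = ‖u‖⁻¹ • u) (hR : 0 < R) :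
    umbrella c u R (frame c b 0 t) = cone c b R t '' Metric.closedBall 0 1 := by
  ext x
  simp only [umbrella, mem_iUnion, mem_image, mem_closedBall_zero_iff, exists_prop]
  have key : ∀ {r : ℝ} {w : ℂ}, 0 ≤ r → ‖w‖ = 1 → cone c b R t (r * w) =
      (1 - r) • frame c b 0 t + r • frame c b (R * w) 0 := by
    intro r w hr hw
    rw [← solid_zero (t₁ := t), solid_mul hr hw]
    simp
  constructor
  · rintro ⟨A, hA, hx⟩
    obtain ⟨z, h, rfl⟩ := frame_surjective (c := c) (b := b) A
    obtain ⟨rfl, hz⟩ := (frame_mem_baseCircle hu hb).1 hA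
    obtain ⟨s, r, hs, hr, hsr, rfl⟩ := hx
    have hR' : (R : ℂ) ≠ 0 := by exact_mod_cast hR.ne'
    have hw : ‖z / R‖ = 1 := by
      rw [norm_div, hz, Complex.norm_real, Real.norm_of_nonneg hR.le, div_self hR.ne']
    refine ⟨r * (z / R), ?_, ?_⟩
    · rw [norm_mul, hw, mul_one, Complex.norm_real, Real.norm_of_nonneg hr]
      linarith
    · rw [key hr hw, mul_div_cancel₀ _ hR', ← hsr, add_sub_cancel_right]
  · rintro ⟨z, hz, rfl⟩
    obtain ⟨r, hr, w, hw, rfl⟩ := exists_mul_of_norm_le_one hz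
    refine ⟨frame c b (R * w) 0, (frame_mem_baseCircle hu hb).2 ⟨rfl, ?_⟩, ?_⟩
    · rw [norm_mul, hw, mul_one, Complex.norm_real, Real.norm_of_nonneg hR.le]
    · exact ⟨1 - r, r, by linarith [hr.2], hr.1, by ring, (key hr.1 hw).symm⟩

theorem solid_mem_convexHull {r l : ℝ} (hr : r ∈ Icc (0 : ℝ) 1) (hl : l ∈ Icc (0 : ℝ) 1)
    {w : ℂ} (hw : ‖w‖ = 1) : solid c b R t₀ t₁ (r * w) l ∈
      convexHull ℝ {frame c b 0 t₀, frame c b 0 t₁, frame c b (R * w) 0} := by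
  rw [solid_mul hr.1 hw, frame_zero_combo]
  refine convex_convexHull ℝ _ (convex_convexHull ℝ _ (subset_convexHull ℝ _ (by simp))
    (subset_convexHull ℝ _ (by simp)) ?_ hl.1 ?_) (subset_convexHull ℝ _ (by simp)) ?_ hr.1 ?_
  · linarith [hl.2]
  · ring
  · linarith [hr.2]
  · ring

theorem convexHull_subset_dicone (hu : u ≠ 0) (hb : b 0 = ‖u‖⁻¹ • u) (hR : 0 < R)
    {w : ℂ} (hw : ‖w‖ = 1) :
    convexHull ℝ {frame c b 0 t₀, frame c b 0 t₁, frame c b (R * w) 0} ⊆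
      dicone c u R (frame c b 0 t₀) (frame c b 0 t₁) := by
  refine subset_biUnion_of_mem (u := fun A => convexHull ℝ {frame c b 0 t₀, frame c b 0 t₁, A}) ?_
  refine (frame_mem_baseCircle hu hb).2 ⟨rfl, ?_⟩
  rw [norm_mul, hw, mul_one, Complex.norm_real, Real.norm_of_nonneg hR.le]

theorem dicone_eq (hu : u ≠ 0) (hb : b 0 = ‖u‖⁻¹ • u) (hR : 0 < R) :
    dicone c u R (frame c b 0 t₀) (frame c b 0 t₁) =
      (fun p : ℂ × ℝ => solid c b R t₀ t₁ p.1 p.2) '' (Metric.closedBall 0 1 ×ˢ Icc 0 1) := by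
  apply Subset.antisymm
  · intro x hx
    simp only [dicone, mem_iUnion, exists_prop] at hx
    obtain ⟨A, hA, hx⟩ := hx
    obtain ⟨z, h, rfl⟩ := frame_surjective (c := c) (b := b) A
    obtain ⟨rfl, hz⟩ := (frame_mem_baseCircle hu hb).1 hA
    have hR' : (R : ℂ) ≠ 0 := by exact_mod_cast hR.ne'
    have hw : ‖z / R‖ = 1 := by
      rw [norm_div, hz, Complex.norm_real, Real.norm_of_nonneg hR.le, div_self hR.ne']
    -- Listing the circle point first presents the triangle as its join with the segment `O₀O₁`,
    -- which matches the parameters `r` and `l`.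
    rw [show ({frame c b 0 t₀, frame c b 0 t₁, frame c b z 0} : Set E3) =
      {frame c b z 0, frame c b 0 t₀, frame c b 0 t₁} by
        ext; simp only [mem_insert_iff, mem_singleton_iff]; tauto,
      convexHull_insert (by simp), convexHull_pair, mem_convexJoin] at hx
    obtain ⟨_, rfl, y, ⟨l', l, hl', hl, hll, rfl⟩, r, s, hr, hs, hrs, rfl⟩ := hx
    refine ⟨(r * (z / R), l), ⟨?_, hl, by linarith⟩, ?_⟩
    · rw [mem_closedBall_zero_iff, norm_mul, hw, mul_one, Complex.norm_real,
        Real.norm_of_nonneg hr]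
      linarith
    · simp only
      obtain rfl : l' = 1 - l := by linarith
      obtain rfl : s = 1 - r := by linarith
      rw [solid_mul hr hw, mul_div_cancel₀ _ hR', frame_zero_combo, add_comm]
  · rintro _ ⟨⟨z, l⟩, ⟨hz, hl⟩, rfl⟩
    obtain ⟨r, hr, w, hw, rfl⟩ := exists_mul_of_norm_le_one (mem_closedBall_zero_iff.1 hz)
    exact convexHull_subset_dicone hu hb hR hw (solid_mem_convexHull hr hl hw)

/-! ### Convexity along the coordinate lines -/

section Convexity

variable {f : E3 → ℝ}

/-- For fixed `l` the point moves affinely in `r` inside a single triangle, a convex subset of the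
dicone. -/
theorem convexOn_solid_radial (hu : u ≠ 0) (hb : b 0 = ‖u‖⁻¹ • u) (hR : 0 < R)
    (hf : IsConvexFunOn (dicone c u R (frame c b 0 t₀) (frame c b 0 t₁)) f)
    {w : ℂ} (hw : ‖w‖ = 1) {l : ℝ} (hl : l ∈ Icc (0 : ℝ) 1) :
    ConvexOn ℝ (Icc 0 1) fun r : ℝ => f (solid c b R t₀ t₁ (r * w) l) := by
  have hT := hf _ (convexHull_subset_dicone hu hb hR hw) (convex_convexHull ℝ _)
  refine ⟨convex_Icc 0 1, fun x hx y hy p q hp hq hpq => ?_⟩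
  refine le_of_eq_of_le ?_ (hT.2 (solid_mem_convexHull hx hl hw) (solid_mem_convexHull hy hl hw)
    hp hq hpq)
  beta_reduce
  congr 1
  obtain rfl : q = 1 - p := by linarith
  have := (convex_Icc (0 : ℝ) 1 hx hy hp hq hpq).1
  rw [solid_mul this hw, solid_mul hx.1 hw, solid_mul hy.1 hw]
  simp only [smul_eq_mul]
  module

theorem convexOn_solid_vertical (hu : u ≠ 0) (hb : b 0 = ‖u‖⁻¹ • u) (hR : 0 < R)
    (hf : IsConvexFunOn (dicone c u R (frame c b 0 t₀) (frame c b 0 t₁)) f)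
    {w : ℂ} (hw : ‖w‖ = 1) {r : ℝ} (hr : r ∈ Icc (0 : ℝ) 1) :
    ConvexOn ℝ (Icc 0 1) fun l : ℝ => f (solid c b R t₀ t₁ (r * w) l) := by
  have hT := hf _ (convexHull_subset_dicone hu hb hR hw) (convex_convexHull ℝ _)
  refine ⟨convex_Icc 0 1, fun x hx y hy p q hp hq hpq => ?_⟩
  refine le_of_eq_of_le ?_ (hT.2 (solid_mem_convexHull hr hx hw) (solid_mem_convexHull hr hy hw)
    hp hq hpq)
  beta_reduce
  congr 1
  obtain rfl : q = 1 - p := by linarith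
  rw [solid_mul hr.1 hw, solid_mul hr.1 hw, solid_mul hr.1 hw, frame_zero_combo, frame_zero_combo,
    frame_zero_combo]
  simp only [smul_eq_mul]
  module

end Convexity

/-! ### Metric of the cone chart -/

theorem dist_cone (z w : ℂ) : dist (cone c b R t z) (cone c b R t w) =
    √(R ^ 2 * ‖z - w‖ ^ 2 + t ^ 2 * (‖z‖ - ‖w‖) ^ 2) := by
  rw [cone, cone, dist_frame, ← mul_sub, norm_mul, Complex.norm_real, Real.norm_eq_abs, mul_pow,
    sq_abs]
  congr 2
  ring

/-- Rotations about the axis and homotheties centred at the vertex map the cone to itself; in the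
chart they are multiplications by complex numbers. -/
theorem dist_cone_mul (a z w : ℂ) :
    dist (cone c b R t (a * z)) (cone c b R t (a * w)) =
      ‖a‖ * dist (cone c b R t z) (cone c b R t w) := by
  rw [dist_cone, dist_cone, ← mul_sub, norm_mul, norm_mul, norm_mul]
  rw [show R ^ 2 * (‖a‖ * ‖z - w‖) ^ 2 + t ^ 2 * (‖a‖ * ‖z‖ - ‖a‖ * ‖w‖) ^ 2 =
    ‖a‖ ^ 2 * (R ^ 2 * ‖z - w‖ ^ 2 + t ^ 2 * (‖z‖ - ‖w‖) ^ 2) by ring,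
    Real.sqrt_mul (by positivity), Real.sqrt_sq (norm_nonneg a)]

theorem lipschitzWith_cone : LipschitzWith (Real.toNNReal √(R ^ 2 + t ^ 2)) (cone c b R t) := by
  refine LipschitzWith.of_dist_le_mul fun z w => ?_
  rw [dist_cone, Real.coe_toNNReal _ (Real.sqrt_nonneg _), dist_eq_norm,
    ← Real.sqrt_sq (norm_nonneg (z - w)), ← Real.sqrt_mul (by positivity),
    Real.sqrt_sq (norm_nonneg (z - w))]
  apply Real.sqrt_le_sqrt
  have h := abs_norm_sub_norm_le z w
  have : (‖z‖ - ‖w‖) ^ 2 ≤ ‖z - w‖ ^ 2 := by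
    rw [← sq_abs]; gcongr
  nlinarith [mul_le_mul_of_nonneg_left this (sq_nonneg t)]

theorem antilipschitzWith_cone (hR : 0 < R) :
    AntilipschitzWith (Real.toNNReal R⁻¹) (cone c b R t) := by
  refine AntilipschitzWith.of_le_mul_dist fun z w => ?_
  rw [dist_cone, Real.coe_toNNReal _ (by positivity), dist_eq_norm, ← div_eq_inv_mul,
    le_div_iff₀ hR]
  apply Real.le_sqrt_of_sq_le
  nlinarith [mul_nonneg (sq_nonneg t) (sq_nonneg (‖z‖ - ‖w‖))]

/-! ### Polar coordinates and averages over umbrellas -/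

/-- Lebesgue measure on the open interval of angles. -/
def angleMeasure : Measure ℝ := volume.restrict (Ioo (-Real.pi) Real.pi)

theorem angleMeasure_univ : angleMeasure univ = ENNReal.ofReal (2 * Real.pi) := by
  rw [angleMeasure, restrict_apply_univ, Real.volume_Ioo]; ring_nf

instance : IsFiniteMeasure angleMeasure := ⟨by rw [angleMeasure_univ]; exact ENNReal.ofReal_lt_top⟩

/-- Polar coordinates on the plane. -/
def polar (p : ℝ × ℝ) : ℂ := p.1 * Complex.exp (p.2 * Complex.I)

theorem continuous_polar : Continuous polar := by unfold polar; fun_prop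

theorem norm_polar {p : ℝ × ℝ} (hp : 0 ≤ p.1) : ‖polar p‖ = p.1 := by
  rw [polar, norm_mul, Complex.norm_exp_ofReal_mul_I, mul_one, Complex.norm_real,
    Real.norm_of_nonneg hp]

theorem prod_unitMeasure_angleMeasure : unitMeasure.prod angleMeasure =
    volume.restrict (Ioo 0 1 ×ˢ Ioo (-Real.pi) Real.pi) := by
  rw [unitMeasure, angleMeasure, prod_restrict]; rfl

theorem setLIntegral_ball_eq (φ : ℂ → ℝ≥0∞) : ∫⁻ z in Metric.ball 0 1, φ z =
    ∫⁻ p, ENNReal.ofReal p.1 * φ (polar p) ∂unitMeasure.prod angleMeasure := by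
  rw [← lintegral_indicator measurableSet_ball, ← Complex.lintegral_comp_polarCoord_symm,
    prod_unitMeasure_angleMeasure, ← lintegral_indicator (by measurability),
    ← lintegral_indicator (by measurability)]
  refine lintegral_congr fun p => ?_
  have e : Complex.polarCoord.symm p = polar p := by
    rw [Complex.polarCoord_symm_apply, polar, Complex.exp_mul_I]; simp
  rw [show polarCoord.target = Ioi (0 : ℝ) ×ˢ Ioo (-Real.pi) Real.pi from rfl]
  by_cases hp : p ∈ Ioi (0 : ℝ) ×ˢ Ioo (-Real.pi) Real.pi
  · rw [indicator_of_mem hp, e, smul_eq_mul]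
    by_cases h1 : p.1 < 1
    · rw [indicator_of_mem, indicator_of_mem]
      · exact ⟨⟨hp.1, h1⟩, hp.2⟩
      · rwa [mem_ball_zero_iff, norm_polar (le_of_lt hp.1)]
    · rw [indicator_of_notMem, indicator_of_notMem, mul_zero]
      · exact fun h => h1 h.1.2
      · rwa [mem_ball_zero_iff, norm_polar (le_of_lt hp.1)]
  · rw [indicator_of_notMem hp, indicator_of_notMem]
    exact fun h => hp ⟨h.1.1, h.2⟩

theorem restrict_closedBall_eq_map_polar : (volume : Measure ℂ).restrict (Metric.closedBall 0 1) =
    ((unitMeasure.prod angleMeasure).withDensity fun p => ENNReal.ofReal p.1).map polar := by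
  have : Metric.closedBall (0 : ℂ) 1 =ᵐ[volume] Metric.ball 0 1 := by
    rw [← Metric.ball_union_sphere]
    exact union_ae_eq_left_of_ae_eq_empty (ae_eq_empty.2 (addHaar_sphere _ _ _))
  rw [restrict_congr_set this]
  ext E hE
  have hE' := continuous_polar.measurable hE
  rw [map_apply continuous_polar.measurable hE, withDensity_apply _ hE',
    ← lintegral_indicator hE', ← lintegral_indicator_one hE, setLIntegral_ball_eq]
  refine lintegral_congr fun p => ?_
  by_cases h : polar p ∈ E
  · rw [indicator_of_mem h, indicator_of_mem (by exact h)]; simp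
  · rw [indicator_of_notMem h, indicator_of_notMem (by exact h)]; simp

theorem exists_restrict_umbrella_eq (hu : u ≠ 0) (hb : b 0 = ‖u‖⁻¹ • u) (hR : 0 < R) :
    ∃ κ : ℝ≥0∞, κ ≠ 0 ∧ κ ≠ ∞ ∧
      surfaceMeasure.restrict (umbrella c u R (frame c b 0 t)) =
        κ • ((unitMeasure.prod angleMeasure).withDensity fun p => ENNReal.ofReal p.1).map
          fun p => cone c b R t (polar p) := by
  obtain ⟨κ, h0, ht, h⟩ := exists_restrict_hausdorffMeasure_eq_map (Ψ := cone c b R t)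
    dist_cone_mul lipschitzWith_cone (antilipschitzWith_cone hR)
    (B := Metric.closedBall 0 1) measurableSet_closedBall
  refine ⟨κ, h0, ht, ?_⟩
  rw [umbrella_eq hu hb hR, surfaceMeasure, h, Measure.map_smul, restrict_closedBall_eq_map_polar,
    Measure.map_map lipschitzWith_cone.continuous.measurable continuous_polar.measurable]
  rfl

theorem integrable_withDensity_ofReal_iff {α : Type*} [MeasurableSpace α] {μ : Measure α}
    {d : α → ℝ} (hd : Measurable d) (h0 : ∀ᵐ x ∂μ, 0 ≤ d x) {g : α → ℝ} :
    Integrable g (μ.withDensity fun x => ENNReal.ofReal (d x)) ↔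
      Integrable (fun x => d x * g x) μ := by
  rw [integrable_withDensity_iff_integrable_smul' (by fun_prop) (by simp)]
  refine integrable_congr ?_
  filter_upwards [h0] with x hx
  simp [ENNReal.toReal_ofReal hx]

theorem integral_withDensity_ofReal {α : Type*} [MeasurableSpace α] {μ : Measure α}
    {d : α → ℝ} (hd : Measurable d) (h0 : ∀ᵐ x ∂μ, 0 ≤ d x) (g : α → ℝ) :
    ∫ x, g x ∂(μ.withDensity fun x => ENNReal.ofReal (d x)) = ∫ x, d x * g x ∂μ := by
  rw [integral_withDensity_eq_integral_toReal_smul (by fun_prop) (by simp)]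
  refine integral_congr_ae ?_
  filter_upwards [h0] with x hx
  simp [ENNReal.toReal_ofReal hx]

theorem ae_nonneg_fst : ∀ᵐ p : ℝ × ℝ ∂unitMeasure.prod angleMeasure, 0 ≤ p.1 :=
  ae_prod_unitMeasure_mem.mono fun _ hp => hp.1.le

theorem infDist_cone_axis (hu : u ≠ 0) (hb : b 0 = ‖u‖⁻¹ • u) (hR : 0 ≤ R) (z : ℂ) :
    Metric.infDist (cone c b R t z) (axis c u : Set E3) = R * ‖z‖ := by
  rw [cone, infDist_frame_axis hu hb, norm_mul, Complex.norm_real, Real.norm_of_nonneg hR]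

/-- Averages over an umbrella in conical coordinates. -/
theorem integrable_cone_and_surfAvg_eq (hu : u ≠ 0) (hb : b 0 = ‖u‖⁻¹ • u) (hR : 0 < R)
    {f : E3 → ℝ} (hg : IntegrableOn (divDist f (axis c u)) (umbrella c u R (frame c b 0 t))
      surfaceMeasure) :
    Integrable (fun p => f (cone c b R t (polar p))) (unitMeasure.prod angleMeasure) ∧
    surfAvg (divDist f (axis c u)) (umbrella c u R (frame c b 0 t)) =
      (Real.pi * R)⁻¹ * ∫ p, f (cone c b R t (polar p)) ∂unitMeasure.prod angleMeasure := by
  obtain ⟨κ, h0, ht, h⟩ := exists_restrict_umbrella_eq (c := c) (t := t) hu hb hR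
  have hm : Measurable fun p => cone c b R t (polar p) :=
    lipschitzWith_cone.continuous.measurable.comp continuous_polar.measurable
  -- The polar Jacobian `r` cancels against the distance `R r` to the axis.
  have hpt : ∀ᵐ p : ℝ × ℝ ∂unitMeasure.prod angleMeasure,
      p.1 * divDist f (axis c u) (cone c b R t (polar p)) = R⁻¹ * f (cone c b R t (polar p)) := by
    filter_upwards [ae_prod_unitMeasure_mem] with p hp
    have := hp.1.ne'
    rw [divDist, infDist_cone_axis hu hb hR.le, norm_polar hp.1.le]
    field_simp
  rw [IntegrableOn, h, integrable_smul_measure h0 ht] at hg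
  have hgm := hg.aestronglyMeasurable
  rw [integrable_map_measure hgm hm.aemeasurable,
    integrable_withDensity_ofReal_iff (by fun_prop) ae_nonneg_fst] at hg
  -- The unknown constant `κ` appears in the area as well as in the integral, so it drops out of the
  -- average.
  have hU : surfaceMeasure.real (umbrella c u R (frame c b 0 t)) = κ.toReal * Real.pi := by
    rw [← measureReal_restrict_apply_univ, h, measureReal_def, Measure.smul_apply,
      map_apply hm .univ, preimage_univ, ← preimage_univ (f := polar),
      ← map_apply continuous_polar.measurable .univ, ← restrict_closedBall_eq_map_polar]
    simp
  constructor
  · have := (hg.congr (hpt.mono fun p hp => hp)).const_mul R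
    refine this.congr (.of_forall fun p => ?_)
    simp [hR.ne']
  · rw [surfAvg, hU, h, integral_smul_measure, integral_map hm.aemeasurable hgm,
      integral_withDensity_ofReal (by fun_prop) ae_nonneg_fst, integral_congr_ae hpt,
      integral_const_mul, smul_eq_mul]
    have : κ.toReal ≠ 0 := ENNReal.toReal_ne_zero.2 ⟨h0, ht⟩
    field_simp

/-! ### Volume in the solid chart -/

theorem isCompact_dicone (hu : u ≠ 0) (hb : b 0 = ‖u‖⁻¹ • u) (hR : 0 < R) :
    IsCompact (dicone c u R (frame c b 0 t₀) (frame c b 0 t₁)) := by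
  rw [dicone_eq hu hb hR]
  exact ((isCompact_closedBall 0 1).prod isCompact_Icc).image continuous_solid

theorem frame_mem_dicone_iff (hu : u ≠ 0) (hb : b 0 = ‖u‖⁻¹ • u) (hR : 0 < R) (z : ℂ) (y : ℝ) :
    frame c b (R * z) y ∈ dicone c u R (frame c b 0 t₀) (frame c b 0 t₁) ↔
      ‖z‖ ≤ 1 ∧ ∃ l ∈ Icc (0 : ℝ) 1, (1 - ‖z‖) * ((1 - l) * t₀ + l * t₁) = y := by
  have hR' : (R : ℂ) ≠ 0 := by exact_mod_cast hR.ne'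
  rw [dicone_eq hu hb hR]
  constructor
  · rintro ⟨⟨w, l⟩, ⟨hw, hl⟩, h⟩
    obtain ⟨h1, h2⟩ := frame_injective h
    obtain rfl := mul_left_cancel₀ hR' h1
    exact ⟨mem_closedBall_zero_iff.1 hw, l, hl, h2⟩
  · rintro ⟨hz, l, hl, rfl⟩
    exact ⟨(z, l), ⟨mem_closedBall_zero_iff.2 hz, hl⟩, rfl⟩

/-- The chord over `R * z` is the image of `[0,1]` under an affine map of slope `(1 - ‖z‖) * (t₁ -
t₀)`; passing to the open interval costs a null set. -/
theorem volume_chord (hu : u ≠ 0) (hb : b 0 = ‖u‖⁻¹ • u) (hR : 0 < R) {z : ℂ} (hz : ‖z‖ < 1)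
    (E : Set E3) :
    volume {y | frame c b (R * z) y ∈ dicone c u R (frame c b 0 t₀) (frame c b 0 t₁) ∩ E} =
      ENNReal.ofReal ((1 - ‖z‖) * |t₁ - t₀|) * unitMeasure {l | solid c b R t₀ t₁ z l ∈ E} := by
  have hs : {y | frame c b (R * z) y ∈ dicone c u R (frame c b 0 t₀) (frame c b 0 t₁) ∩ E} =
      ((1 - ‖z‖) * t₀) +ᵥ ((1 - ‖z‖) * (t₁ - t₀)) •
        ({l | solid c b R t₀ t₁ z l ∈ E} ∩ Icc 0 1) := by
    ext y
    simp only [mem_ofPred_eq, mem_inter_iff, frame_mem_dicone_iff hu hb hR, mem_vadd_set,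
      mem_smul_set, vadd_eq_add, smul_eq_mul, exists_exists_and_eq_and]
    have e : ∀ l : ℝ, (1 - ‖z‖) * t₀ + (1 - ‖z‖) * (t₁ - t₀) * l =
        (1 - ‖z‖) * ((1 - l) * t₀ + l * t₁) := fun l => by ring
    simp only [e]
    constructor
    · rintro ⟨⟨-, l, hl, rfl⟩, h⟩
      exact ⟨l, ⟨h, hl⟩, rfl⟩
    · rintro ⟨l, ⟨h, hl⟩, rfl⟩
      exact ⟨⟨hz.le, l, hl, rfl⟩, h⟩
  rw [hs, measure_vadd, addHaar_smul, unitMeasure, restrict_congr_set Ioo_ae_eq_Icc,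
    Measure.restrict_apply' measurableSet_Icc]
  simp [abs_mul, abs_of_pos (sub_pos.2 hz)]

theorem lintegral_eq_mul_lintegral_comp_mul (hR : 0 < R) (φ : ℂ → ℝ≥0∞) :
    ∫⁻ z, φ z = ENNReal.ofReal (R ^ 2) * ∫⁻ z, φ (R * z) := by
  have h := map_addHaar_smul (volume : Measure ℂ) hR.ne'
  have he : MeasurableEmbedding (fun z : ℂ => R • z) := measurableEmbedding_const_smul₀ hR.ne'
  have h2 : ∫⁻ z, φ (R • z) = ENNReal.ofReal ((R ^ 2)⁻¹) * ∫⁻ z, φ z := by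
    rw [← he.lintegral_map, show (fun z : ℂ => R • z) = (R • ·) from rfl, h,
      lintegral_smul_measure, Complex.finrank_real_complex, abs_of_pos (by positivity), smul_eq_mul]
  simp only [Complex.real_smul] at h2
  rw [h2, ← mul_assoc, ← ENNReal.ofReal_mul (by positivity), mul_inv_cancel₀ (by positivity)]
  simp

/-- The volume on the dicone in adapted polar coordinates. -/
theorem restrict_dicone_eq (hu : u ≠ 0) (hb : b 0 = ‖u‖⁻¹ • u) (hR : 0 < R) :
    volume.restrict (dicone c u R (frame c b 0 t₀) (frame c b 0 t₁)) =
      (((unitMeasure.prod angleMeasure).prod unitMeasure).withDensity fun p =>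
        ENNReal.ofReal (R ^ 2 * |t₁ - t₀| * (p.1.1 * (1 - p.1.1)))).map
        fun p => solid c b R t₀ t₁ (polar p.1) p.2 := by
  have hcont : Continuous fun p : (ℝ × ℝ) × ℝ => solid c b R t₀ t₁ (polar p.1) p.2 :=
    continuous_solid.comp (f := fun p : (ℝ × ℝ) × ℝ => (polar p.1, p.2))
      ((continuous_polar.comp continuous_fst).prodMk continuous_snd)
  ext E hE
  have hS := (isCompact_dicone (c := c) (t₀ := t₀) (t₁ := t₁) hu hb hR).measurableSet.inter hE
  have hS' := continuous_frame (c := c) (b := b) |>.measurable hS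
  have hE' := hcont.measurable hE
  rw [Measure.restrict_apply hE, inter_comm, ← measurePreserving_frame (c := c) (b := b)
    |>.measure_preimage hS.nullMeasurableSet, volume_eq_prod, prod_apply hS',
    lintegral_eq_mul_lintegral_comp_mul hR, map_apply hcont.measurable hE,
    withDensity_apply _ hE', ← lintegral_indicator hE', lintegral_prod _ (by
      refine (Measurable.indicator ?_ hE').aemeasurable
      fun_prop)]
  -- Over `‖z‖ > 1` the slice is empty, and the circle `‖z‖ = 1` is null, so only the open disc,
  -- where `volume_chord` applies, contributes.
  have hball : ∫⁻ z : ℂ, volume (Prod.mk ((R : ℂ) * z) ⁻¹' ((fun p : ℂ × ℝ => frame c b p.1 p.2) ⁻¹'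
      (dicone c u R (frame c b 0 t₀) (frame c b 0 t₁) ∩ E))) =
      ∫⁻ z in Metric.ball (0 : ℂ) 1, volume {y | frame c b (R * z) y ∈
        dicone c u R (frame c b 0 t₀) (frame c b 0 t₁) ∩ E} := by
    rw [← lintegral_indicator measurableSet_ball]
    have : ∀ᵐ z : ℂ, z ∉ Metric.sphere (0 : ℂ) 1 :=
      measure_eq_zero_iff_ae_notMem.1 (addHaar_sphere _ _ _)
    refine lintegral_congr_ae ?_
    filter_upwards [this] with z hz
    by_cases h : z ∈ Metric.ball (0 : ℂ) 1
    · rw [indicator_of_mem h]; rfl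
    · rw [indicator_of_notMem h]
      refine measure_mono_null (t := ∅) (fun y hy => ?_) measure_empty
      have h1 := ((frame_mem_dicone_iff hu hb hR z y).1 hy.1).1
      rw [mem_ball_zero_iff] at h
      rw [mem_sphere_zero_iff_norm] at hz
      exact (h (lt_of_le_of_ne h1 hz)).elim
  rw [hball, setLIntegral_ball_eq, ← lintegral_const_mul' _ _ ENNReal.ofReal_ne_top]
  refine lintegral_congr_ae ?_
  filter_upwards [ae_prod_unitMeasure_mem] with p hp
  have hn := norm_polar hp.1.le
  rw [volume_chord hu hb hR (by rw [hn]; exact hp.2), hn]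
  have hi : ∀ l, ((fun p : (ℝ × ℝ) × ℝ => solid c b R t₀ t₁ (polar p.1) p.2) ⁻¹' E).indicator
      (fun p => ENNReal.ofReal (R ^ 2 * |t₁ - t₀| * (p.1.1 * (1 - p.1.1)))) (p, l) =
      {l | solid c b R t₀ t₁ (polar p) l ∈ E}.indicator
      (fun _ => ENNReal.ofReal (R ^ 2 * |t₁ - t₀| * (p.1 * (1 - p.1)))) l := fun l => rfl
  simp only [hi]
  have hm : MeasurableSet {l | solid c b R t₀ t₁ (polar p) l ∈ E} :=
    (hcont.comp (Continuous.prodMk_right p)).measurable hE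
  -- The density collects `R ^ 2` from scaling the disc, `r` from polar coordinates and `(1 - r) *
  -- |t₁ - t₀|` from the chord.
  rw [lintegral_indicator_const hm, ← mul_assoc, ← mul_assoc, ← ENNReal.ofReal_mul (by positivity),
    ← ENNReal.ofReal_mul (mul_nonneg (by positivity) hp.1.le)]
  congr 2
  ring

/-! ### Interior of the dicone: continuity and a lower bound -/

/-- The interior points of the dicone. -/
def openDicone (c : E3) (b : OrthonormalBasis (Fin 3) ℝ E3) (R t₀ t₁ : ℝ) : Set E3 :=
  (fun p : ℂ × ℝ => frame c b (R * p.1) p.2) ''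
    -- Positivity of the product says that the height lies strictly between the two umbrellas,
    -- whichever of `t₀`, `t₁` is larger.
    {p | ‖p.1‖ < 1 ∧ 0 < (p.2 - (1 - ‖p.1‖) * t₀) * ((1 - ‖p.1‖) * t₁ - p.2)}

theorem isOpen_openDicone (hR : 0 < R) : IsOpen (openDicone c b R t₀ t₁) := by
  have hR' : (R : ℂ) ≠ 0 := by exact_mod_cast hR.ne'
  set g : E3 → ℂ × ℝ := fun x => ((⟨b.repr (x - c) 1, b.repr (x - c) 2⟩ : ℂ) / R, b.repr (x - c) 0)
    with hg
  have hgc : Continuous g := by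
    have : ∀ i, Continuous fun x => b.repr (x - c) i := fun i => by fun_prop
    have e : g = fun x => (((b.repr (x - c) 1 : ℂ) + (b.repr (x - c) 2 : ℂ) * Complex.I) / R,
        b.repr (x - c) 0) := by
      funext x; rw [hg]; simp only [Complex.mk_eq_add_mul_I]
    rw [e]
    exact (((Complex.continuous_ofReal.comp (this 1)).add ((Complex.continuous_ofReal.comp
      (this 2)).mul continuous_const)).div_const _).prodMk (this 0)
  have hl : ∀ p, g (frame c b (R * p.1) p.2) = p := by
    intro p
    simp only [hg, repr_frame_sub]
    ext1
    · rw [div_eq_iff hR']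
      apply Complex.ext <;> simp [mul_comm]
    · simp
  have hr : ∀ x, frame c b (R * (g x).1) (g x).2 = x := by
    intro x
    obtain ⟨z, h, rfl⟩ := frame_surjective (c := c) (b := b) x
    have := hl (z / R, h)
    simp only [mul_div_cancel₀ _ hR'] at this
    rw [this]
    simp only [mul_div_cancel₀ _ hR']
  rw [openDicone, image_eq_preimage_of_inverse hl hr]
  refine IsOpen.preimage hgc (IsOpen.and (isOpen_lt ?_ ?_) (isOpen_lt ?_ ?_)) <;> fun_prop

theorem solid_mem_openDicone (hne : t₀ ≠ t₁) {z : ℂ} (hz : ‖z‖ < 1) {l : ℝ}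
    (hl : l ∈ Ioo (0 : ℝ) 1) : solid c b R t₀ t₁ z l ∈ openDicone c b R t₀ t₁ := by
  refine ⟨(z, _), ⟨hz, ?_⟩, rfl⟩
  have h1 : 0 < 1 - ‖z‖ := sub_pos.2 hz
  have h2 : 0 < (t₁ - t₀) ^ 2 := by
    have := sub_ne_zero.2 hne.symm
    positivity
  have h3 := sub_pos.2 hl.2
  have h4 := hl.1
  calc 0 < (1 - ‖z‖) ^ 2 * (l * (1 - l)) * (t₁ - t₀) ^ 2 := by positivity
    _ = _ := by ring

theorem openDicone_subset (hu : u ≠ 0) (hb : b 0 = ‖u‖⁻¹ • u) (hR : 0 < R) :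
    openDicone c b R t₀ t₁ ⊆ dicone c u R (frame c b 0 t₀) (frame c b 0 t₁) := by
  rintro _ ⟨⟨z, y⟩, ⟨hz, hy⟩, rfl⟩
  refine (frame_mem_dicone_iff hu hb hR z y).2 ⟨hz.le, ?_⟩
  simp only at hz hy
  have hs : 0 < 1 - ‖z‖ := sub_pos.2 hz
  set s := 1 - ‖z‖
  -- If the two ends of the chord coincided, the product in `hy` would be minus a square.
  have hd : s * (t₁ - t₀) ≠ 0 := by
    intro h0
    have : s * t₁ = s * t₀ := by linarith
    rw [this] at hy
    nlinarith [sq_nonneg (y - s * t₀)]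
  refine ⟨(y - s * t₀) / (s * (t₁ - t₀)), ⟨?_, ?_⟩, ?_⟩
  · rcases pos_and_pos_or_neg_and_neg_of_mul_pos hy with h | h
    · exact div_nonneg h.1.le (by linarith)
    · exact div_nonneg_of_nonpos h.1.le (by linarith)
  · rcases pos_and_pos_or_neg_and_neg_of_mul_pos hy with h | h
    · exact (div_le_one (by linarith)).2 (by linarith)
    · exact (div_le_one_of_neg (by linarith)).2 (by linarith)
  · have h1 : t₁ - t₀ ≠ 0 := right_ne_zero_of_mul hd
    field_simp
    ring

/-- Continuity is local, and small balls are convex subsets of the dicone, on which a convex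
function is continuous in the interior. -/
theorem continuousOn_openDicone (hu : u ≠ 0) (hb : b 0 = ‖u‖⁻¹ • u) (hR : 0 < R) {f : E3 → ℝ}
    (hf : IsConvexFunOn (dicone c u R (frame c b 0 t₀) (frame c b 0 t₁)) f) :
    ContinuousOn f (openDicone c b R t₀ t₁) := by
  intro x hx
  obtain ⟨ε, hε, hball⟩ := Metric.isOpen_iff.1 (isOpen_openDicone hR) x hx
  have hc := hf _ (hball.trans (openDicone_subset hu hb hR)) (convex_ball x ε)
  exact ((hc.continuousOn Metric.isOpen_ball).continuousAt
    (Metric.ball_mem_nhds x hε)).continuousWithinAt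

/-- The points involved lie on the image of a circle, compact and inside the open dicone, where `f`
is continuous. This makes the lower bound uniform in the angle. -/
theorem exists_le_solid (hu : u ≠ 0) (hb : b 0 = ‖u‖⁻¹ • u) (hR : 0 < R) (hne : t₀ ≠ t₁)
    {f : E3 → ℝ} (hf : IsConvexFunOn (dicone c u R (frame c b 0 t₀) (frame c b 0 t₁)) f)
    {r l : ℝ} (hr : r ∈ Ioo (0 : ℝ) 1) (hl : l ∈ Ioo (0 : ℝ) 1) :
    ∃ M, ∀ w : ℝ, M ≤ f (solid c b R t₀ t₁ (polar (r, w)) l) := by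
  have hc : Continuous fun z => solid c b R t₀ t₁ z l :=
    continuous_solid.comp (f := fun z : ℂ => (z, l)) (Continuous.prodMk_left l)
  have hmaps : MapsTo (fun z => solid c b R t₀ t₁ z l) (Metric.sphere 0 r)
      (openDicone c b R t₀ t₁) := fun z hz =>
    solid_mem_openDicone hne (by rw [mem_sphere_zero_iff_norm.1 hz]; exact hr.2) hl
  have hcf := (continuousOn_openDicone hu hb hR hf).comp hc.continuousOn hmaps
  obtain ⟨M, hM⟩ := (isCompact_sphere (0 : ℂ) r).bddBelow_image hcf
  refine ⟨M, fun w => hM (mem_image_of_mem _ ?_)⟩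
  exact mem_sphere_zero_iff_norm.2 (norm_polar hr.1.le)

end Dicone

end

/-! ### The inequality for the dicone -/

open Dicone Set in
theorem mainTheorem7 (c u : Dicone.E3) (hu : u ≠ 0) (R : ℝ) (hR : 0 < R)
    (O₀ O₁ : Dicone.E3) (h₀ : O₀ ∈ Dicone.axis c u) (h₁ : O₁ ∈ Dicone.axis c u)
    (hne : O₀ ≠ O₁) (f : Dicone.E3 → ℝ)
    (hf : Dicone.IsConvexFunOn (Dicone.dicone c u R O₀ O₁) f)
    (hg₀ : IntegrableOn (Dicone.divDist f (Dicone.axis c u))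
      (Dicone.umbrella c u R O₀) Dicone.surfaceMeasure)
    (hg₁ : IntegrableOn (Dicone.divDist f (Dicone.axis c u))
      (Dicone.umbrella c u R O₁) Dicone.surfaceMeasure) :
    IntegrableOn f (Dicone.dicone c u R O₀ O₁) ∧
    Dicone.volAvg f (Dicone.dicone c u R O₀ O₁) ≤
      R / 4 * (Dicone.surfAvg (Dicone.divDist f (Dicone.axis c u)) (Dicone.umbrella c u R O₀) +
        Dicone.surfAvg (Dicone.divDist f (Dicone.axis c u)) (Dicone.umbrella c u R O₁)) := by
  obtain ⟨b, hb⟩ := exists_basis_zero_eq hu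
  obtain ⟨z₀, t₀, rfl⟩ := frame_surjective (c := c) (b := b) O₀
  obtain ⟨z₁, t₁, rfl⟩ := frame_surjective (c := c) (b := b) O₁
  obtain rfl := (frame_mem_axis hu hb).1 h₀
  obtain rfl := (frame_mem_axis hu hb).1 h₁
  have hne' : t₀ ≠ t₁ := fun h => hne (by rw [h])
  obtain ⟨i₀, a₀⟩ := integrable_cone_and_surfAvg_eq hu hb hR hg₀
  obtain ⟨i₁, a₁⟩ := integrable_cone_and_surfAvg_eq hu hb hR hg₁
  set ν := (unitMeasure.prod angleMeasure).prod unitMeasure with hν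
  set S : (ℝ × ℝ) × ℝ → E3 := fun p => solid c b R t₀ t₁ (polar p.1) p.2 with hS
  have hSc : Continuous S := continuous_solid.comp (f := fun p : (ℝ × ℝ) × ℝ => (polar p.1, p.2))
      ((continuous_polar.comp continuous_fst).prodMk continuous_snd)
  set D := dicone c u R (frame c b 0 t₀) (frame c b 0 t₁)
  have hD : volume.restrict D = _ := restrict_dicone_eq (c := c) (t₀ := t₀) (t₁ := t₁) hu hb hR
  have hfc := continuousOn_openDicone hu hb hR hf
  have hopen := isOpen_openDicone (c := c) (b := b) (t₀ := t₀) (t₁ := t₁) hR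
  have hSmem : ∀ᵐ p ∂ν, S p ∈ openDicone c b R t₀ t₁ := by
    filter_upwards [ae_prod_prod_unitMeasure_mem] with p hp
    exact solid_mem_openDicone hne' (by rw [norm_polar hp.1.1.le]; exact hp.1.2) hp.2
  set d : (ℝ × ℝ) × ℝ → ℝ := fun p => R ^ 2 * |t₁ - t₀| * (p.1.1 * (1 - p.1.1)) with hd
  have hdm : Measurable d := by fun_prop
  have hd0 : ∀ᵐ p ∂ν, 0 ≤ d p := by
    filter_upwards [ae_prod_prod_unitMeasure_mem] with p hp
    have h1 := hp.1.1
    have h2 := sub_pos.2 hp.1.2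
    positivity
  -- Measurability of `f` comes from its continuity on the open dicone, which carries all of the
  -- volume.
  have hfD : AEStronglyMeasurable f (volume.restrict D) := by
    have : (volume.restrict D).restrict (openDicone c b R t₀ t₁) = volume.restrict D := by
      refine restrict_eq_self_of_ae_mem ?_
      rw [hD]
      exact (ae_map_iff (p := fun x => x ∈ openDicone c b R t₀ t₁) hSc.measurable.aemeasurable
        hopen.measurableSet).2 ((withDensity_absolutelyContinuous _ _).ae_le hSmem)
    rw [← this]
    exact hfc.aestronglyMeasurable hopen.measurableSet
  have hfS : AEStronglyMeasurable (fun p => f (S p)) ν := by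
    have : (fun p => f (S p)) = f ∘ S := rfl
    have hr : ν.restrict (S ⁻¹' openDicone c b R t₀ t₁) = ν := restrict_eq_self_of_ae_mem hSmem
    rw [this, ← hr]
    exact (hfc.comp hSc.continuousOn (mapsTo_preimage _ _)).aestronglyMeasurable
      (hSc.measurable hopen.measurableSet)
  obtain ⟨M, hM⟩ := exists_le_solid hu hb hR hne' hf
    (r := 1 / 2) (l := 1 / 2) (by norm_num) (by norm_num)
  have hexp : ∀ w : ℝ, ‖Complex.exp (w * Complex.I)‖ = 1 := Complex.norm_exp_ofReal_mul_I
  obtain ⟨hI, hle⟩ := integrable_and_integral_le (μ := angleMeasure)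
    (F := fun p l => f (S (p, l))) (M := M)
    (fun w l hl => convexOn_solid_radial hu hb hR hf (hexp w) hl)
    (fun w r hr => convexOn_solid_vertical hu hb hR hf (hexp w) hr) hfS hM
    (by simpa only [hS, solid_zero] using i₀) (by simpa only [hS, solid_one] using i₁)
  have hint : ∀ g : E3 → ℝ, AEStronglyMeasurable g (volume.restrict D) →
      ∫ x in D, g x = R ^ 2 * |t₁ - t₀| * ∫ p, p.1.1 * (1 - p.1.1) * g (S p) ∂ν := by
    intro g hg
    rw [hD] at hg ⊢
    rw [integral_map hSc.measurable.aemeasurable hg, integral_withDensity_ofReal hdm hd0,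
      ← integral_const_mul]
    simp only [hd, mul_assoc]
  -- The volume is the change of variables applied to the constant `1`; the weight integrates to
  -- `1/6 * 2π`.
  have hvol : volume.real D = R ^ 2 * |t₁ - t₀| * (Real.pi / 3) := by
    have h1 := hint (fun _ => 1) aestronglyMeasurable_const
    have h2 : ∫ p : (ℝ × ℝ) × ℝ, p.1.1 * (1 - p.1.1) * 1 ∂ν = Real.pi / 3 := by
      have e1 := integral_prod_mul (μ := unitMeasure.prod angleMeasure) (ν := unitMeasure)
        (fun p => p.1 * (1 - p.1)) (fun _ => (1 : ℝ))
      have e2 := integral_prod_mul (μ := unitMeasure) (ν := angleMeasure)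
        (fun r => r * (1 - r)) (fun _ => (1 : ℝ))
      simp only [mul_one] at e1 e2 ⊢
      rw [e1, e2, integral_unitMeasure_mul_one_sub]
      simp [measureReal_def, angleMeasure_univ, Real.pi_nonneg]
      ring
    rw [h2] at h1
    simpa using h1
  constructor
  · rw [IntegrableOn, hD]
    rw [hD] at hfD
    rw [integrable_map_measure hfD hSc.measurable.aemeasurable,
      integrable_withDensity_ofReal_iff hdm hd0]
    refine (hI.const_mul (R ^ 2 * |t₁ - t₀|)).congr (.of_forall fun p => ?_)
    simp only [hS, hd, mul_assoc, Function.comp]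
  · rw [volAvg, hvol, hint f hfD, a₀, a₁]
    simp only [hS, solid_zero, solid_one] at hle
    have h1 : 0 < |t₁ - t₀| := abs_pos.2 (sub_ne_zero.2 hne'.symm)
    have hpi := Real.pi_pos
    -- The constants combine as `(3/π) * (1/12) * (π R) = R/4`.
    calc _ = 3 / Real.pi * ∫ p, p.1.1 * (1 - p.1.1) * f (S p) ∂ν := by field_simp
      _ ≤ 3 / Real.pi * _ := mul_le_mul_of_nonneg_left hle (by positivity)
      _ = _ := by field_simp; ring
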